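/- Let $\alpha$ be an irrational real number and let $k\ge 1$ be an integer. For finite words $u,w$ over $\{0,1\}$ with $w$ nonempty, let $|u|_w$ be the number of occurrences of $w$ as a factor of $u$. Words $u,v$ are $k$-abelian equivalent if $|u|_w=|v|_w$ for every nonempty word $w$ of length at most $k$. A $k$-abelian power of exponent $n$ and period $m$ is a concatenation $u_0u_1\cdots u_{n-1}$ of $n$ pairwise $k$-abelian equivalent words of length $m$ (exponent $n=1$ is allowed). A Sturmian word of slope $\alpha$ is an infinite word whose $n$-th letter ($n\ge 0$) is $0$ if $\{x+n\alpha\}\in I_0$ and $1$ if $\{x+n\alpha\}\in I_1$, for some point $x$ of the circle $\mathbb{T}=\mathbb{R}/\mathbb{Z}$ (identified with $[0,1)$), where either $I_0=[0,\{1-\alpha\})$ and $I_1=[\{1-\alpha\},1)$, or $I_0=(0,\{1-\alpha\}]$ and $I_1=(\{1-\alpha\},1]$ (the points $0$ and $1$ being identified). Let $\mathcal{A}_{k,\alpha}(m)$ be the maximum exponent of a $k$-abelian power of period $m$ occurring in a Sturmian word of slope $\alpha$, and define the $k$-abelian critical exponent of slope $\alpha$ as $$\mathcal{A}c_k(\alpha)=\limsup_{m\to\infty}\frac{\mathcal{A}_{k,\alpha}(m)}{m}\in[0,\infty].$$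 For $n\ge 0$ let $\max L(n)$ be the maximal length of one of the $n+1$ intervals into which the points $0,\{-\alpha\},\{-2\alpha\},\ldots,\{-n\alpha\}$ divide the circle $\mathbb{T}$. Then the following hold. 1. For every $m\ge 1$, the number $\mathcal{A}_{k,\alpha}(m)$ does not depend on the choice of the Sturmian word of slope $\alpha$. 2. $\mathcal{A}c_k(\alpha)=\max L(2k-2)\cdot \mathcal{A}c_1(\alpha)$, where both sides may be $\infty$. 3. $\mathcal{A}c_k(\alpha)$ is finite if and only if the partial quotients of the continued fraction expansion of $\alpha$ are bounded. -/

import Mathlib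

open scoped ENNReal

noncomputable section

namespace KAbelian

/-- The number of occurrences `|u|_w` of a nonempty word `w` as a factor of the word `u`. -/
def occurrences (u w : List (Fin 2)) : ℕ :=
  ((Finset.range u.length).filter (fun i => w <+: u.drop i)).card

/-- `u ∼ₖ v`: every nonempty word of length at most `k` occurs equally often in `u` and `v`. -/
def Equivalent (k : ℕ) (u v : List (Fin 2)) : Prop :=
  ∀ w : List (Fin 2), w ≠ [] → w.length ≤ k → occurrences u w = occurrences v w

/-- `u` is a concatenation of `n` pairwise `k`-abelian equivalent words of length `m`. -/
def IsPower (k n m : ℕ) (u : List (Fin 2)) : Prop :=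
  ∃ blocks : List (List (Fin 2)), blocks.length = n ∧ (∀ b ∈ blocks, b.length = m) ∧
    (∀ b ∈ blocks, ∀ c ∈ blocks, Equivalent k b c) ∧ u = blocks.flatten

/-- The finite word `u` occurs in the infinite word `s`. -/
def OccursIn (u : List (Fin 2)) (s : ℕ → Fin 2) : Prop :=
  ∃ i : ℕ, u = (List.range u.length).map (fun j => s (i + j))

/-- Coding of the orbit of `x` with `I₀ = [0, {1 - α})` and `I₁ = [{1 - α}, 1)`. -/
def lowerWord (α x : ℝ) (n : ℕ) : Fin 2 :=
  if Int.fract (x + n * α) < Int.fract (1 - α) then 0 else 1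

/-- Coding of the orbit of `x` with `I₀ = (0, {1 - α}]` and `I₁ = ({1 - α}, 1]`
(the point `0 = 1` of the circle lies in `I₁`). -/
def upperWord (α x : ℝ) (n : ℕ) : Fin 2 :=
  if 0 < Int.fract (x + n * α) ∧ Int.fract (x + n * α) ≤ Int.fract (1 - α) then 0 else 1

/-- `s` is a Sturmian word of slope `α` (used for irrational `α`): the coding of the orbit of some
point under the rotation by `α`, with either choice of endpoints. -/
def IsSturmian (α : ℝ) (s : ℕ → Fin 2) : Prop :=
  ∃ x : ℝ, s = lowerWord α x ∨ s = upperWord α x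

/-- The largest exponent of a `k`-abelian power of period `m` occurring in the word `s`. -/
def maxExponentOfWord (k : ℕ) (s : ℕ → Fin 2) (m : ℕ) : ℕ∞ :=
  sSup {e : ℕ∞ | ∃ n : ℕ, e = n ∧ ∃ u, IsPower k n m u ∧ OccursIn u s}

/-- The largest exponent of a `k`-abelian power of period `m` occurring in Sturmian words of
slope `α`. -/
def maxExponent (k : ℕ) (α : ℝ) (m : ℕ) : ℕ∞ :=
  sSup {e : ℕ∞ | ∃ n : ℕ, e = n ∧ ∃ u, IsPower k n m u ∧ ∃ s, IsSturmian α s ∧ OccursIn u s}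

/-- The `k`-abelian critical exponent of slope `α`. -/
def criticalExponent (k : ℕ) (α : ℝ) : ℝ≥0∞ :=
  Filter.limsup (fun m : ℕ => (maxExponent k α m : ℝ≥0∞) / (m : ℝ≥0∞)) Filter.atTop

/-- The points `0, {-α}, …, {-nα}` of `[0, 1)`. -/
def cutPoints (α : ℝ) (n : ℕ) : Finset ℝ :=
  (Finset.range (n + 1)).image (fun i : ℕ => Int.fract (-(i * α)))

/-- The level `n` intervals, given by their endpoints `(a, b)`: `a < b` are consecutive elements
of the cut points together with `1`. -/
def levelIntervals (α : ℝ) (n : ℕ) : Finset (ℝ × ℝ) :=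
  (cutPoints α n ×ˢ insert 1 (cutPoints α n)).filter
    (fun p => p.1 < p.2 ∧ ∀ c ∈ cutPoints α n, ¬ (p.1 < c ∧ c < p.2))

theorem levelIntervals_nonempty (α : ℝ) (n : ℕ) : (levelIntervals α n).Nonempty := by
  have h0 : (0 : ℝ) ∈ cutPoints α n := by
    simp only [cutPoints, Finset.mem_image, Finset.mem_range]
    exact ⟨0, by omega, by simp⟩
  have hne : (cutPoints α n).Nonempty := ⟨0, h0⟩
  refine ⟨((cutPoints α n).max' hne, 1), ?_⟩
  have hm := (cutPoints α n).max'_mem hne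
  simp only [levelIntervals, Finset.mem_filter, Finset.mem_product, Finset.mem_insert]
  refine ⟨⟨hm, by simp⟩, ?_, fun c hc h => absurd ((cutPoints α n).le_max' c hc) (not_le.2 h.1)⟩
  obtain ⟨i, -, hi⟩ := Finset.mem_image.1 hm
  rw [← hi]
  exact Int.fract_lt_one _

/-- `max L(n)`: the maximal length of a level `n` interval. -/
def maxLevelLength (α : ℝ) (n : ℕ) : ℝ :=
  (levelIntervals α n).sup' (levelIntervals_nonempty α n) (fun p => p.2 - p.1)

/-- The partial quotients `a₁, a₂, …` of the continued fraction of `α` are bounded. -/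
def HasBoundedPartialQuotients (α : ℝ) : Prop :=
  ∃ C : ℝ, ∀ (t : ℕ) (a : ℝ), (GenContFract.of α).partDens.get? t = some a → a ≤ C

end KAbelian

end

/-! Let F be the floor or the ceiling, according to the endpoint convention of the coding. The
letter read at y is F(y+α) − F(y) − ⌊α⌋, so counting factors in a block amounts to summing
increments of F along an orbit.

The indicator of a word w is an integer combination of 1 and the deviations F(y+iα) − F(y) − ⌊iα⌋
with i ≤ |w|. Summed over all positions in a block these telescope, leaving only values of F near
the two ends. Hence blocks of length m at y and z are k-abelian equivalent as soon as F agrees at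
y+rα and z+rα, and at y+mα−rα and z+mα−rα, for r < k (`equivalent_coding`). Conversely, equivalence
forces equal prefixes and suffixes of length less than k and equal numbers of ones.

The blocks of a power start at y+jδ modulo 1, where δ = mα − round(mα) and |δ| = ‖mα‖. A power
therefore exists when these points, shifted by −(k−1)α, stay in one level 2k−2 interval; conversely,
a long power forces this for all but boundedly many of them. So the maximal exponent is max
L(2k−2)/‖mα‖ up to a bounded error (`maxExponent_le`, `le_maxExponent`). Dividing by m gives Ac_k(α)
= max L(2k−2) · limsup 1/(m‖mα‖), and max L(0) = 1 turns the second factor into Ac_1(α). Its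
finiteness is the classical criterion for bounded partial quotients, proved with Legendre's theorem
and the error of the convergents.

Independence of the Sturmian word holds because each finite coding is seen from a whole open
interval of points, which every orbit visits (`exists_coding_eq`). -/

namespace KAbelian

/-! ### Codings of rotations through floor and ceiling -/

/-- The properties shared by the floor and the ceiling function that determine the codings of
rotations. -/
structure IsRounding (F : ℝ → ℤ) : Prop where
  mono : Monotone F
  add_int : ∀ (x : ℝ) (n : ℤ), F (x + n) = F x + n
  lt_of_lt_of_lt : ∀ (x : ℝ) (n : ℤ) (y : ℝ), x < n → n < y → F x < F y
  le_add_one : ∀ x : ℝ, (F x : ℝ) ≤ x + 1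
  sub_one_le : ∀ x : ℝ, x - 1 ≤ F x

theorem isRounding_floor : IsRounding (Int.floor : ℝ → ℤ) where
  mono := Int.floor_mono
  add_int := Int.floor_add_intCast
  lt_of_lt_of_lt x n y hx hy := (Int.floor_lt.2 hx).trans_le (Int.le_floor.2 hy.le)
  le_add_one x := by linarith [Int.floor_le x]
  sub_one_le x := by linarith [Int.lt_floor_add_one x]

theorem isRounding_ceil : IsRounding (Int.ceil : ℝ → ℤ) where
  mono := Int.ceil_mono
  add_int := Int.ceil_add_intCast
  lt_of_lt_of_lt x n y hx hy := (Int.ceil_le.2 hx.le).trans_lt (Int.lt_ceil.2 hy)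
  le_add_one x := (Int.ceil_lt_add_one x).le
  sub_one_le x := by linarith [Int.le_ceil x]

/-- The letter read at the point `y` by the coding of the rotation by `α` attached to `F`. -/
noncomputable def letter (F : ℝ → ℤ) (α y : ℝ) : Fin 2 :=
  if F (y + α) = F y + ⌊α⌋ then 0 else 1

/-- The first `N` letters of the coding of the orbit of `y`. -/
noncomputable def coding (F : ℝ → ℤ) (α y : ℝ) (N : ℕ) : List (Fin 2) :=
  (List.range N).map fun j : ℕ => letter F α (y + j * α)

theorem lowerWord_eq_letter {α : ℝ} (hα : Irrational α) (x : ℝ) (n : ℕ) :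
    lowerWord α x n = letter Int.floor α (x + n * α) := by
  have h0 : 0 < Int.fract α := Int.fract_pos.2 fun h => hα.ne_int _ h
  have h1 : Int.fract (1 - α) = 1 - Int.fract α := by
    rw [sub_eq_add_neg, add_comm, Int.fract_add_one, Int.fract_neg h0.ne']
  unfold lowerWord letter
  set z := x + n * α
  rw [h1]
  have key : ⌊z + α⌋ = ⌊z⌋ + ⌊α⌋ ↔ Int.fract z < 1 - Int.fract α := by
    rw [Int.floor_eq_iff]
    push_cast
    have := Int.self_sub_floor z
    have := Int.self_sub_floor α
    have := Int.fract_nonneg z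
    have := Int.fract_nonneg α
    constructor
    · rintro ⟨-, h⟩
      linarith
    · intro h
      constructor <;> linarith
  simp only [key]

theorem upperWord_eq_letter {α : ℝ} (hα : Irrational α) (x : ℝ) (n : ℕ) :
    upperWord α x n = letter Int.ceil α (x + n * α) := by
  have h0 : 0 < Int.fract α := Int.fract_pos.2 fun h => hα.ne_int _ h
  have h1 : Int.fract (1 - α) = 1 - Int.fract α := by
    rw [sub_eq_add_neg, add_comm, Int.fract_add_one, Int.fract_neg h0.ne']
  unfold upperWord letter
  set z := x + n * α
  rw [h1]
  have key : ⌈z + α⌉ = ⌈z⌉ + ⌊α⌋ ↔ 0 < Int.fract z ∧ Int.fract z ≤ 1 - Int.fract α := by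
    rw [Int.ceil_eq_iff]
    push_cast
    have hz := Int.self_sub_floor z
    have := Int.self_sub_floor α
    have := Int.fract_nonneg z
    have := Int.fract_lt_one α
    rcases (Int.fract_nonneg z).eq_or_lt with h | h
    · have hc : (⌈z⌉ : ℝ) = z := by
        rw [← h] at hz
        have hz' : z = (⌊z⌋ : ℝ) := by linarith
        rw [hz', Int.ceil_intCast]
      rw [hc, ← h]
      constructor
      · rintro ⟨-, h⟩
        linarith
      · rintro ⟨h, -⟩
        exact absurd h (lt_irrefl _)
    · have hc : (⌈z⌉ : ℝ) = z + 1 - Int.fract z := Int.ceil_eq_add_one_sub_fract h.ne'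
      rw [hc]
      constructor
      · rintro ⟨h1, h2⟩
        exact ⟨h, by linarith⟩
      · rintro ⟨h1, h2⟩
        constructor <;> linarith
  simp only [key]

theorem isSturmian_iff {α : ℝ} (hα : Irrational α) (s : ℕ → Fin 2) :
    IsSturmian α s ↔ ∃ x : ℝ, ∃ F : ℝ → ℤ, (F = Int.floor ∨ F = Int.ceil) ∧
      s = fun n : ℕ => letter F α (x + n * α) := by
  refine exists_congr fun x => ?_
  have h1 : lowerWord α x = fun n : ℕ => letter Int.floor α (x + n * α) :=
    funext (lowerWord_eq_letter hα x)
  have h2 : upperWord α x = fun n : ℕ => letter Int.ceil α (x + n * α) :=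
    funext (upperWord_eq_letter hα x)
  rw [h1, h2]
  constructor
  · rintro (h | h)
    exacts [⟨_, .inl rfl, h⟩, ⟨_, .inr rfl, h⟩]
  · rintro ⟨F, rfl | rfl, h⟩
    exacts [.inl h, .inr h]

theorem isRounding_of_eq {F : ℝ → ℤ} (h : F = Int.floor ∨ F = Int.ceil) : IsRounding F := by
  rcases h with rfl | rfl
  exacts [isRounding_floor, isRounding_ceil]

theorem occursIn_iff (F : ℝ → ℤ) (α x : ℝ) (u : List (Fin 2)) :
    OccursIn u (fun n : ℕ => letter F α (x + n * α)) ↔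
      ∃ i : ℕ, u = coding F α (x + i * α) u.length := by
  refine exists_congr fun i => ?_
  rw [coding]
  have : (fun j : ℕ => letter F α (x + ((i + j : ℕ) : ℝ) * α)) =
      fun j : ℕ => letter F α (x + i * α + j * α) := by
    funext j
    push_cast
    ring_nf
  rw [this]

/-! ### Factors of codings and powers -/

section coding

variable {F : ℝ → ℤ} {α : ℝ}

@[simp] theorem length_coding (F : ℝ → ℤ) (α y : ℝ) (N : ℕ) : (coding F α y N).length = N := by
  simp [coding]

theorem coding_zero (F : ℝ → ℤ) (α y : ℝ) : coding F α y 0 = [] := rfl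

theorem coding_add (F : ℝ → ℤ) (α y : ℝ) (M N : ℕ) :
    coding F α y (M + N) = coding F α y M ++ coding F α (y + M * α) N := by
  simp only [coding, List.range_add, List.map_append, List.map_map]
  congr 2
  funext j
  simp only [Function.comp_apply]
  push_cast
  ring_nf

theorem coding_succ (F : ℝ → ℤ) (α y : ℝ) (N : ℕ) :
    coding F α y (N + 1) = coding F α y N ++ [letter F α (y + N * α)] := by
  rw [coding_add]
  simp [coding]

theorem take_coding (y : ℝ) {M N : ℕ} (h : M ≤ N) :
    (coding F α y N).take M = coding F α y M := by
  obtain ⟨d, rfl⟩ := Nat.exists_eq_add_of_le h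
  rw [coding_add, List.take_append_of_le_length (by simp), List.take_of_length_le (by simp)]

theorem drop_coding (y : ℝ) {M N : ℕ} (h : M ≤ N) :
    (coding F α y N).drop M = coding F α (y + M * α) (N - M) := by
  obtain ⟨d, rfl⟩ := Nat.exists_eq_add_of_le h
  rw [coding_add, List.drop_append_of_le_length (by simp), List.drop_of_length_le (by simp)]
  simp

theorem isPrefix_coding_iff (y : ℝ) (N : ℕ) (w : List (Fin 2)) :
    w <+: coding F α y N ↔ w.length ≤ N ∧ coding F α y w.length = w := by
  rw [List.prefix_iff_eq_take]
  constructor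
  · intro h
    have hl : w.length ≤ N := by
      have := congrArg List.length h
      simp at this
      omega
    rw [take_coding y hl] at h
    exact ⟨hl, h.symm⟩
  · rintro ⟨hl, h⟩
    rw [take_coding y hl, h]

theorem occurrences_coding (y : ℝ) (m : ℕ) {w : List (Fin 2)} (hw : w ≠ [])
    (hm : w.length ≤ m) :
    occurrences (coding F α y m) w =
      ((Finset.range (m - w.length + 1)).filter
        fun i : ℕ => coding F α (y + i * α) w.length = w).card := by
  have hpos := List.length_pos_iff.2 hw
  unfold occurrences
  congr 1
  ext i
  simp only [Finset.mem_filter, Finset.mem_range, length_coding]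
  constructor
  · rintro ⟨h1, h2⟩
    rw [drop_coding y h1.le, isPrefix_coding_iff] at h2
    exact ⟨by omega, h2.2⟩
  · rintro ⟨h1, h2⟩
    refine ⟨by omega, ?_⟩
    rw [drop_coding y (by omega), isPrefix_coding_iff]
    exact ⟨by omega, h2⟩

theorem occurrences_eq_zero {u w : List (Fin 2)} (h : u.length < w.length) :
    occurrences u w = 0 := by
  unfold occurrences
  rw [Finset.card_eq_zero, Finset.filter_eq_empty_iff]
  intro i _ hi
  have := hi.length_le
  simp at this
  omega

theorem coding_add_int (hF : IsRounding F) (y : ℝ) (p : ℤ) (N : ℕ) :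
    coding F α (y + p) N = coding F α y N := by
  unfold coding
  congr 1
  funext j
  unfold letter
  have h1 : y + p + j * α + α = y + j * α + α + p := by ring
  have h2 : y + p + j * α = y + j * α + p := by ring
  rw [h1, h2, hF.add_int, hF.add_int]
  congr 1
  apply propext
  constructor <;> intro h <;> linarith

theorem coding_eq_flatten (F : ℝ → ℤ) (α y : ℝ) (n m : ℕ) :
    coding F α y (n * m) =
      ((List.range n).map fun j : ℕ => coding F α (y + (j * m : ℕ) * α) m).flatten := by
  induction n with
  | zero => simp [coding_zero]
  | succ n ih =>
    rw [List.range_succ, List.map_append, List.flatten_append, ← ih, add_mul, one_mul, coding_add]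
    simp

theorem isPower_coding (k n m : ℕ) (y : ℝ)
    (h : ∀ i < n, ∀ j < n, Equivalent k (coding F α (y + (i * m : ℕ) * α) m)
      (coding F α (y + (j * m : ℕ) * α) m)) :
    IsPower k n m (coding F α y (n * m)) := by
  refine ⟨_, ?_, ?_, ?_, coding_eq_flatten F α y n m⟩
  · simp
  · simp
  · simpa using h

theorem exists_of_isPower_coding {k n m N : ℕ} {y : ℝ} (h : IsPower k n m (coding F α y N)) :
    ∀ i < n, ∀ j < n, Equivalent k (coding F α (y + (i * m : ℕ) * α) m)
      (coding F α (y + (j * m : ℕ) * α) m) := by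
  obtain ⟨bs, hlen, hb, heq, hu⟩ := h
  have hmap : bs.map List.length = List.replicate n m := by
    rw [List.eq_replicate_iff]
    simpa [hlen] using hb
  have hN : N = n * m := by
    have := congrArg List.length hu
    rw [length_coding, List.length_flatten, hmap] at this
    simpa using this
  -- A list of words is determined by its concatenation and the lengths of its members.
  have hbs : bs = (List.range n).map fun j : ℕ => coding F α (y + (j * m : ℕ) * α) m := by
    rw [List.eq_iff_flatten_eq, ← hu, hN, coding_eq_flatten, hmap]
    refine ⟨rfl, ?_⟩
    rw [eq_comm, List.eq_replicate_iff]
    simp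
  subst hbs
  simpa using heq

end coding

/-! ### All Sturmian words of slope α have the same factors -/

section recurrence

open Filter Topology

theorem exists_nat_add_int_mem_Ioo {α : ℝ} (hα : Irrational α) (x : ℝ) {c d : ℝ} (hcd : c < d) :
    ∃ (n : ℕ) (p : ℤ), x + n * α + p ∈ Set.Ioo c d := by
  have hd : DenseRange (· • (α : AddCircle (1 : ℝ)) : ℕ → AddCircle (1 : ℝ)) := by
    rw [← denseRange_zsmul_iff_nsmul, AddCircle.denseRange_zsmul_coe_iff, div_one]
    exact hα
  have ho : IsOpen ((QuotientAddGroup.mk : ℝ → AddCircle (1 : ℝ)) '' Set.Ioo (c - x) (d - x)) :=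
    QuotientAddGroup.isOpenMap_coe _ isOpen_Ioo
  obtain ⟨n, t, ht, hn⟩ := hd.exists_mem_open ho ((Set.nonempty_Ioo.2 (by linarith)).image _)
  have h1 : ((t - n * α : ℝ) : AddCircle (1 : ℝ)) = 0 := by
    have h2 : ((n * α : ℝ) : AddCircle (1 : ℝ)) = n • (α : AddCircle (1 : ℝ)) := by
      rw [← nsmul_eq_mul]
      rfl
    rw [AddCircle.coe_sub, h2]
    exact sub_eq_zero.2 hn
  obtain ⟨p, hp⟩ := (AddCircle.coe_eq_zero_iff (1 : ℝ)).1 h1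
  refine ⟨n, p, ?_⟩
  have hp' : (p : ℝ) = t - n * α := by simpa using hp
  rw [hp']
  constructor <;> linarith [ht.1, ht.2]

theorem letter_congr {F G : ℝ → ℤ} {α y z : ℝ} {c : ℤ} (h0 : F y = G z + c)
    (h1 : F (y + α) = G (z + α) + c) : letter F α y = letter G α z := by
  unfold letter
  rw [h0, h1]
  congr 1
  apply propext
  constructor <;> intro h <;> linarith

theorem coding_congr {F G : ℝ → ℤ} {α y z : ℝ} {c : ℤ} {N : ℕ}
    (h : ∀ i : ℕ, i ≤ N → F (y + i * α) = G (z + i * α) + c) :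
    coding F α y N = coding G α z N := by
  unfold coding
  refine List.map_congr_left fun i hi => ?_
  have hi := List.mem_range.1 hi
  refine letter_congr (h i hi.le) ?_
  have := h (i + 1) hi
  push_cast at this
  have e : ∀ y : ℝ, y + i * α + α = y + (i + 1) * α := fun y => by ring
  rw [e, e, this]

/-- Immediately to the right of y no floor changes and all the points z + iα avoid the integers, so
floor and ceiling differ by exactly one there. -/
theorem exists_Ioo_floor_ceil (α y : ℝ) (N : ℕ) : ∃ c d : ℝ, c < d ∧ ∀ z ∈ Set.Ioo c d,
    ∀ i : ℕ, i ≤ N → ⌊z + i * α⌋ = ⌊y + i * α⌋ ∧ ⌈z + i * α⌉ = ⌊y + i * α⌋ + 1 := by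
  have h : ∀ᶠ z in 𝓝[>] y, ∀ i ∈ Finset.range (N + 1),
      ⌊z + i * α⌋ = ⌊y + i * α⌋ ∧ ⌈z + i * α⌉ = ⌊y + i * α⌋ + 1 := by
    rw [Filter.eventually_all_finset]
    intro i _
    have hlt : y < ⌊y + i * α⌋ + 1 - i * α := by linarith [Int.lt_floor_add_one (y + i * α)]
    filter_upwards [Ioo_mem_nhdsGT hlt] with z hz
    have h1 := Int.floor_le (y + i * α)
    have h2 := hz.1
    have h3 := hz.2
    rw [Int.floor_eq_iff, Int.ceil_eq_iff]
    push_cast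
    refine ⟨⟨?_, ?_⟩, ?_, ?_⟩ <;> linarith
  obtain ⟨d, hd, hsub⟩ := mem_nhdsGT_iff_exists_Ioo_subset.1 h
  exact ⟨y, d, hd, fun z hz i hi => hsub hz i (Finset.mem_range.2 (by omega))⟩

theorem exists_Ioo_ceil_floor (α y : ℝ) (N : ℕ) : ∃ c d : ℝ, c < d ∧ ∀ z ∈ Set.Ioo c d,
    ∀ i : ℕ, i ≤ N → ⌈z + i * α⌉ = ⌈y + i * α⌉ ∧ ⌊z + i * α⌋ = ⌈y + i * α⌉ - 1 := by
  obtain ⟨c, d, hcd, h⟩ := exists_Ioo_floor_ceil (-α) (-y) N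
  refine ⟨-d, -c, by linarith, fun z hz i hi => ?_⟩
  obtain ⟨h1, h2⟩ := h (-z) ⟨by linarith [hz.2], by linarith [hz.1]⟩ i hi
  have e : ∀ y : ℝ, -y + i * -α = -(y + i * α) := fun y => by ring
  rw [e, e, Int.floor_neg, Int.floor_neg] at h1
  rw [e, e, Int.ceil_neg, Int.floor_neg] at h2
  constructor <;> linarith

/-- On a one-sided neighbourhood of y (right for the floor, left for the ceiling) the values of G
differ from those of F at y by one common constant b. Letters see only increments, so b is
invisible, and density brings the orbit of x into the neighbourhood. -/
theorem exists_coding_eq {α : ℝ} (hα : Irrational α) {F G : ℝ → ℤ}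
    (hF : F = Int.floor ∨ F = Int.ceil) (hG : G = Int.floor ∨ G = Int.ceil) (x y : ℝ) (N : ℕ) :
    ∃ n : ℕ, coding G α (x + n * α) N = coding F α y N := by
  obtain ⟨c, d, b, hcd, h⟩ : ∃ c d : ℝ, ∃ b : ℤ, c < d ∧ ∀ z ∈ Set.Ioo c d,
      ∀ i : ℕ, i ≤ N → G (z + i * α) = F (y + i * α) + b := by
    rcases hF with rfl | rfl
    · obtain ⟨c, d, hcd, h⟩ := exists_Ioo_floor_ceil α y N
      rcases hG with rfl | rfl
      · exact ⟨c, d, 0, hcd, fun z hz i hi => by rw [(h z hz i hi).1, add_zero]⟩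
      · exact ⟨c, d, 1, hcd, fun z hz i hi => (h z hz i hi).2⟩
    · obtain ⟨c, d, hcd, h⟩ := exists_Ioo_ceil_floor α y N
      rcases hG with rfl | rfl
      · exact ⟨c, d, -1, hcd, fun z hz i hi => (h z hz i hi).2⟩
      · exact ⟨c, d, 0, hcd, fun z hz i hi => by rw [(h z hz i hi).1, add_zero]⟩
  obtain ⟨n, p, hp⟩ := exists_nat_add_int_mem_Ioo hα x hcd
  refine ⟨n, ?_⟩
  rw [← coding_add_int (isRounding_of_eq hG) _ p]
  exact coding_congr (h _ hp)

theorem OccursIn.of_isSturmian {α : ℝ} (hα : Irrational α) {s t : ℕ → Fin 2}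
    (hs : IsSturmian α s) (ht : IsSturmian α t) {u : List (Fin 2)} (h : OccursIn u s) :
    OccursIn u t := by
  obtain ⟨x, F, hF, rfl⟩ := (isSturmian_iff hα s).1 hs
  obtain ⟨y, G, hG, rfl⟩ := (isSturmian_iff hα t).1 ht
  rw [occursIn_iff] at h ⊢
  obtain ⟨i, hi⟩ := h
  obtain ⟨n, hn⟩ := exists_coding_eq hα hF hG y (x + i * α) u.length
  exact ⟨n, by rw [hn]; exact hi⟩

theorem maxExponentOfWord_eq_maxExponent {α : ℝ} (hα : Irrational α) {s : ℕ → Fin 2}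
    (hs : IsSturmian α s) (k m : ℕ) : maxExponentOfWord k s m = maxExponent k α m := by
  unfold maxExponentOfWord maxExponent
  congr 1
  ext e
  refine exists_congr fun n => and_congr_right fun _ => exists_congr fun u =>
    and_congr_right fun _ => ⟨fun h => ⟨s, hs, h⟩, ?_⟩
  rintro ⟨t, ht, h⟩
  exact h.of_isSturmian hα ht hs

end recurrence

/-! ### Equivalent words share their short prefixes and suffixes -/

section occurrences

theorem occurrences_nil_left (w : List (Fin 2)) : occurrences [] w = 0 := by
  simp [occurrences]

theorem occurrences_cons (a : Fin 2) (u w : List (Fin 2)) :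
    occurrences (a :: u) w = (if w <+: a :: u then 1 else 0) + occurrences u w := by
  simp only [occurrences, Finset.card_filter, List.length_cons]
  rw [Finset.sum_range_succ', add_comm]
  simp

/-- An occurrence of w is either at the very beginning or preceded by exactly one letter. For |w| <
k this recovers the prefix from counts of words of length at most k. -/
theorem occurrences_eq_prefix_add (u : List (Fin 2)) {w : List (Fin 2)} (hw : w ≠ []) :
    occurrences u w = (if w <+: u then 1 else 0) + ∑ a : Fin 2, occurrences u (a :: w) := by
  induction u with
  | nil => simp [occurrences_nil_left, hw]
  | cons c u ih =>
    simp only [occurrences_cons, Finset.sum_add_distrib, List.cons_prefix_cons]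
    rw [ih]
    have : (∑ a : Fin 2, if a = c ∧ w <+: u then 1 else 0) = if w <+: u then 1 else 0 := by
      by_cases h : w <+: u <;> simp [h]
    rw [this]

theorem isPrefix_concat_iff (u w : List (Fin 2)) :
    (if w <+: u then 1 else 0) =
      (if w = u then 1 else 0) + ∑ a : Fin 2, if w ++ [a] <+: u then 1 else 0 := by
  by_cases h : w <+: u
  · obtain ⟨t, rfl⟩ := h
    have hlen : ∀ a : Fin 2, ¬ w ++ [a] <+: w := fun a ha => by simpa using ha.length_le
    cases t with
    | nil => simp [hlen]
    | cons b t =>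
      simp [List.prefix_append_right_inj, List.cons_prefix_cons]
  · have h1 : w ≠ u := fun e => h (e ▸ List.prefix_rfl)
    have h2 : ∀ a, ¬ w ++ [a] <+: u := fun a ha => h ((List.prefix_append _ _).trans ha)
    simp [h, h1, h2]

theorem occurrences_eq_suffix_add (u : List (Fin 2)) {w : List (Fin 2)} (hw : w ≠ []) :
    occurrences u w = (if w <:+ u then 1 else 0) + ∑ a : Fin 2, occurrences u (w ++ [a]) := by
  induction u with
  | nil => simp [occurrences_nil_left, hw]
  | cons c u ih =>
    simp only [occurrences_cons, Finset.sum_add_distrib]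
    rw [ih, isPrefix_concat_iff]
    have : (if w <:+ c :: u then 1 else 0) =
        (if w = c :: u then 1 else 0) + if w <:+ u then 1 else 0 := by
      have hlen : ¬ c :: u <:+ u := fun h => by simpa using h.length_le
      by_cases h : w = c :: u
      · simp [h, hlen]
      · simp only [List.suffix_cons_iff, h, false_or, if_false, zero_add]
    rw [this]
    ring

theorem Equivalent.isPrefix {k : ℕ} {u v w : List (Fin 2)} (h : Equivalent k u v)
    (hw : w.length < k) (hu : w <+: u) : w <+: v := by
  rcases eq_or_ne w [] with rfl | hne
  · exact List.nil_prefix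
  have h1 := h w hne hw.le
  rw [occurrences_eq_prefix_add u hne, occurrences_eq_prefix_add v hne, if_pos hu,
    Finset.sum_congr rfl fun a _ => h (a :: w) (by simp) (by simpa using hw)] at h1
  by_contra hv
  rw [if_neg hv] at h1
  omega

theorem Equivalent.isSuffix {k : ℕ} {u v w : List (Fin 2)} (h : Equivalent k u v)
    (hw : w.length < k) (hu : w <:+ u) : w <:+ v := by
  rcases eq_or_ne w [] with rfl | hne
  · exact List.nil_suffix
  have h1 := h w hne hw.le
  rw [occurrences_eq_suffix_add u hne, occurrences_eq_suffix_add v hne, if_pos hu,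
    Finset.sum_congr rfl fun a _ => h (w ++ [a]) (by simp) (by simpa using hw)] at h1
  by_contra hv
  rw [if_neg hv] at h1
  omega

end occurrences

/-! ### k-abelian equivalence in terms of the rounding function -/

section span

variable {F : ℝ → ℤ} {α : ℝ}

/-- The deviation `F (y + iα) - F y - ⌊iα⌋`, which is `0` or `1`. -/
noncomputable def deviation (F : ℝ → ℤ) (α : ℝ) (i : ℕ) (y : ℝ) : ℤ := F (y + i * α) - F y - ⌊i * α⌋

theorem deviation_eq (hF : IsRounding F) (i : ℕ) (y : ℝ) :
    deviation F α i y = F (y + Int.fract (i * α)) - F y := by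
  have : y + i * α = y + Int.fract (i * α) + (⌊i * α⌋ : ℤ) := by
    rw [add_assoc, Int.fract_add_floor]
  rw [deviation, this, hF.add_int]
  ring

theorem deviation_eq_zero_or_one (hF : IsRounding F) (i : ℕ) (y : ℝ) :
    deviation F α i y = 0 ∨ deviation F α i y = 1 := by
  rw [deviation_eq hF]
  have h1 := hF.mono (show y ≤ y + Int.fract (i * α) by linarith [Int.fract_nonneg (i * α)])
  have h2 := hF.mono (show y + Int.fract (i * α) ≤ y + (1 : ℤ) by
    push_cast
    linarith [Int.fract_lt_one (i * α)])
  rw [hF.add_int] at h2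
  omega

/-- Deviations are indicators of sets that grow with the fractional part of iα. This nesting is what
makes their span closed under products. -/
theorem deviation_mul_of_le (hF : IsRounding F) {i j : ℕ}
    (h : Int.fract (i * α) ≤ Int.fract (j * α)) :
    deviation F α i * deviation F α j = deviation F α i := by
  funext y
  have h1 : deviation F α i y ≤ deviation F α j y := by
    rw [deviation_eq hF, deviation_eq hF]
    have := hF.mono (show y + Int.fract (i * α) ≤ y + Int.fract (j * α) by linarith)
    linarith
  simp only [Pi.mul_apply]
  rcases deviation_eq_zero_or_one (α := α) hF i y with h2 | h2 <;>
    rcases deviation_eq_zero_or_one (α := α) hF j y with h3 | h3 <;>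
      rw [h2, h3] at h1 ⊢ <;> omega

/-- The functions `1` and `deviation F α i` with `i ≤ N`. -/
noncomputable def stepFunctions (F : ℝ → ℤ) (α : ℝ) (N : ℕ) : Set (ℝ → ℤ) :=
  insert 1 {φ | ∃ i ≤ N, φ = deviation F α i}

theorem stepFunctions_mono {M N : ℕ} (h : M ≤ N) : stepFunctions F α M ⊆ stepFunctions F α N :=
  Set.insert_subset_insert fun _ ⟨i, hi, e⟩ => ⟨i, hi.trans h, e⟩

theorem mul_mem_span_stepFunctions (hF : IsRounding F) {N : ℕ} {φ ψ : ℝ → ℤ}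
    (hφ : φ ∈ Submodule.span ℤ (stepFunctions F α N))
    (hψ : ψ ∈ Submodule.span ℤ (stepFunctions F α N)) :
    φ * ψ ∈ Submodule.span ℤ (stepFunctions F α N) := by
  have h := Submodule.mul_mem_mul hφ hψ
  rw [Submodule.span_mul_span] at h
  refine Submodule.span_mono ?_ h
  rintro _ ⟨f, hf, g, hg, rfl⟩
  rcases hf with rfl | ⟨i, hi, rfl⟩
  · simpa using hg
  rcases hg with rfl | ⟨j, hj, rfl⟩
  · exact .inr ⟨i, hi, by simp⟩
  rcases le_total (Int.fract (i * α)) (Int.fract (j * α)) with h | h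
  · exact .inr ⟨i, hi, deviation_mul_of_le hF h⟩
  · exact .inr ⟨j, hj, by simpa only [mul_comm] using deviation_mul_of_le hF h⟩

theorem one_mem_span_stepFunctions (N : ℕ) :
    (1 : ℝ → ℤ) ∈ Submodule.span ℤ (stepFunctions F α N) :=
  Submodule.subset_span (.inl rfl)

theorem deviation_mem_span_stepFunctions {i N : ℕ} (h : i ≤ N) :
    deviation F α i ∈ Submodule.span ℤ (stepFunctions F α N) :=
  Submodule.subset_span (.inr ⟨i, h, rfl⟩)

/-- The indicator function of the set of points whose coding starts with `w`. -/
noncomputable def indicatorCoding (F : ℝ → ℤ) (α : ℝ) (w : List (Fin 2)) (y : ℝ) : ℤ :=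
  if coding F α y w.length = w then 1 else 0

theorem letter_eq_one_indicator (hF : IsRounding F) (y : ℝ) :
    (if letter F α y = 1 then (1 : ℤ) else 0) = F (y + α) - F y - ⌊α⌋ := by
  have h := deviation_eq_zero_or_one (α := α) hF 1 y
  simp only [deviation, Nat.cast_one, one_mul] at h
  rcases h with h | h
  · have hl : letter F α y = 0 := if_pos (by linarith)
    simp [h, hl]
  · have hl : letter F α y = 1 := if_neg (by omega)
    simp [h, hl]

theorem letter_eq_indicator_mem (hF : IsRounding F) (a : Fin 2) (N : ℕ) :
    (fun y => if letter F α (y + N * α) = a then (1 : ℤ) else 0) ∈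
      Submodule.span ℤ (stepFunctions F α (N + 1)) := by
  have h1 : (fun y => if letter F α (y + N * α) = 1 then (1 : ℤ) else 0) ∈
      Submodule.span ℤ (stepFunctions F α (N + 1)) := by
    have : (fun y => if letter F α (y + N * α) = 1 then (1 : ℤ) else 0) =
        deviation F α (N + 1) - deviation F α N +
          (⌊((N + 1 : ℕ) : ℝ) * α⌋ - ⌊N * α⌋ - ⌊α⌋) • (1 : ℝ → ℤ) := by
      funext y
      rw [letter_eq_one_indicator hF]
      have e : y + N * α + α = y + ((N + 1 : ℕ) : ℝ) * α := by push_cast; ring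
      simp only [deviation, Pi.add_apply, Pi.sub_apply, Pi.smul_apply, Pi.one_apply, smul_eq_mul, e]
      ring
    rw [this]
    exact add_mem (sub_mem (deviation_mem_span_stepFunctions le_rfl)
      (deviation_mem_span_stepFunctions (Nat.le_succ N)))
      (Submodule.smul_mem _ _ (one_mem_span_stepFunctions _))
  have ha : a = 1 ∨ a = 0 := by omega
  rcases ha with rfl | rfl
  · exact h1
  · have : (fun y => if letter F α (y + N * α) = 0 then (1 : ℤ) else 0) =
        1 - fun y => if letter F α (y + N * α) = 1 then (1 : ℤ) else 0 := by
      funext y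
      simp only [Pi.sub_apply, Pi.one_apply]
      have : letter F α (y + N * α) = 1 ∨ letter F α (y + N * α) = 0 := by omega
      rcases this with h | h <;> simp [h]
    rw [this]
    exact sub_mem (one_mem_span_stepFunctions _) h1

theorem indicatorCoding_mem (hF : IsRounding F) (w : List (Fin 2)) :
    indicatorCoding F α w ∈ Submodule.span ℤ (stepFunctions F α w.length) := by
  induction w using List.reverseRecOn with
  | nil =>
    have : indicatorCoding F α [] = 1 := by
      funext y
      simp [indicatorCoding, coding_zero]
    rw [this]
    exact one_mem_span_stepFunctions _
  | append_singleton w a ih =>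
    have : indicatorCoding F α (w ++ [a]) = indicatorCoding F α w *
        fun y => if letter F α (y + w.length * α) = a then (1 : ℤ) else 0 := by
      funext y
      simp only [indicatorCoding, Pi.mul_apply, List.length_append, List.length_singleton,
        coding_succ, ite_mul, one_mul, zero_mul]
      by_cases h : coding F α y w.length = w
      · rw [if_pos h, h]
        simp
      · rw [if_neg h, if_neg]
        intro h'
        exact h (List.append_inj_left h' (by simp))
    rw [this, List.length_append, List.length_singleton]
    exact mul_mem_span_stepFunctions hF
      (Submodule.span_mono (stepFunctions_mono (Nat.le_succ _)) ih) (letter_eq_indicator_mem hF a _)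

/-- Both sides are the sum of f over [0, M+q) minus its sums over [0, M) and [0, q). -/
theorem sum_range_shift_sub (f : ℕ → ℤ) (M q : ℕ) :
    ∑ i ∈ Finset.range M, (f (i + q) - f i) = ∑ r ∈ Finset.range q, (f (r + M) - f r) := by
  have h1 := Finset.sum_range_add f q M
  have h2 := Finset.sum_range_add f M q
  rw [add_comm q M] at h1
  simp only [Finset.sum_sub_distrib, add_comm _ q, add_comm _ M]
  linarith

theorem equivalent_coding (hF : IsRounding F) {k m : ℕ} {y z : ℝ}
    (h1 : ∀ r : ℕ, r < k → F (y + r * α) = F (z + r * α))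
    (h2 : ∀ r : ℕ, r < k → F (y + m * α - r * α) = F (z + m * α - r * α)) :
    Equivalent k (coding F α y m) (coding F α z m) := by
  intro w hw hwk
  rcases lt_or_ge m w.length with hm | hm
  · rw [occurrences_eq_zero (by simpa using hm), occurrences_eq_zero (by simpa using hm)]
  have hpos := List.length_pos_iff.2 hw
  rw [occurrences_coding y m hw hm, occurrences_coding z m hw hm]
  have key : ∀ φ ∈ Submodule.span ℤ (stepFunctions F α w.length),
      ∑ i ∈ Finset.range (m - w.length + 1), φ (y + (i : ℕ) * α) =
        ∑ i ∈ Finset.range (m - w.length + 1), φ (z + (i : ℕ) * α) := by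
    intro φ hφ
    induction hφ using Submodule.span_induction with
    | mem φ hφ =>
      rcases hφ with rfl | ⟨q, hq, rfl⟩
      · simp
      -- The long sum over positions is traded for one over r < q ≤ |w|, which involves only the
      -- ends of the block.
      have hs : ∀ x : ℝ, ∑ i ∈ Finset.range (m - w.length + 1), deviation F α q (x + (i : ℕ) * α) =
          ∑ r ∈ Finset.range q, (F (x + (r + (m - w.length + 1) : ℕ) * α) - F (x + (r : ℕ) * α)) -
            ∑ i ∈ Finset.range (m - w.length + 1), ⌊q * α⌋ := by
        intro x
        rw [← sum_range_shift_sub fun i : ℕ => F (x + i * α), ← Finset.sum_sub_distrib]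
        refine Finset.sum_congr rfl fun i _ => ?_
        rw [deviation]
        push_cast
        ring_nf
      rw [hs, hs]
      congr 1
      refine Finset.sum_congr rfl fun r hr => ?_
      have hr := Finset.mem_range.1 hr
      -- Counted back from the end of the block, the offset is |w| − 1 − r, which is less than k.
      have e : ∀ x : ℝ, x + (r + (m - w.length + 1) : ℕ) * α =
          x + m * α - (w.length - 1 - r : ℕ) * α := by
        intro x
        have : (r + (m - w.length + 1) : ℕ) + (w.length - 1 - r : ℕ) = m := by omega
        have := congrArg (Nat.cast : ℕ → ℝ) this
        rw [Nat.cast_add] at this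
        linear_combination α * this
      rw [e, e, h1 r (by omega), h2 _ (by omega)]
    | zero => simp
    | add f g _ _ hf hg => simp only [Pi.add_apply, Finset.sum_add_distrib, hf, hg]
    | smul c f _ hf => simp only [Pi.smul_apply, ← Finset.smul_sum, hf]
  have := key _ (indicatorCoding_mem hF w)
  simp only [indicatorCoding, Finset.sum_boole] at this
  exact_mod_cast this

theorem eq_of_coding_eq (hF : IsRounding F) {y z : ℝ} {N : ℕ}
    (h : coding F α y N = coding F α z N) {i : ℕ} (hi : i ≤ N) :
    F (y + i * α) - F y = F (z + i * α) - F z := by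
  induction i with
  | zero => simp
  | succ i ih =>
    have hl : letter F α (y + i * α) = letter F α (z + i * α) := by
      have := congrArg (fun l => l[i]?) h
      simpa [coding, show i < N from hi] using this
    have h1 := letter_eq_one_indicator (α := α) hF (y + i * α)
    have h2 := letter_eq_one_indicator (α := α) hF (z + i * α)
    rw [hl, h2] at h1
    have e : ∀ y : ℝ, y + ((i + 1 : ℕ) : ℝ) * α = y + i * α + α := fun y => by push_cast; ring
    rw [e, e]
    have := ih (by omega)
    linarith

theorem Equivalent.eq_start (hF : IsRounding F) {k m : ℕ} {y z : ℝ}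
    (h : Equivalent k (coding F α y m) (coding F α z m)) {i : ℕ} (hik : i < k) (him : i ≤ m) :
    F (y + i * α) - F y = F (z + i * α) - F z := by
  have hp := h.isPrefix (w := coding F α y i) (by simpa using hik)
    ((isPrefix_coding_iff y m _).2 ⟨by simpa using him, by simp⟩)
  have := ((isPrefix_coding_iff z m _).1 hp).2
  rw [length_coding] at this
  exact (eq_of_coding_eq hF this le_rfl).symm

theorem Equivalent.eq_end (hF : IsRounding F) {k m : ℕ} {y z : ℝ}
    (h : Equivalent k (coding F α y m) (coding F α z m)) {i : ℕ} (hik : i < k) (him : i ≤ m) :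
    F (y + m * α) - F (y + m * α - i * α) = F (z + m * α) - F (z + m * α - i * α) := by
  have hd : ∀ x : ℝ, (coding F α x m).drop (m - i) = coding F α (x + m * α - i * α) i := by
    intro x
    rw [drop_coding x (Nat.sub_le m i), Nat.sub_sub_self him, Nat.cast_sub him]
    ring_nf
  have hs := h.isSuffix (w := coding F α (y + m * α - i * α) i) (by simpa using hik)
    (hd y ▸ List.drop_suffix _ _)
  rw [List.suffix_iff_eq_drop, length_coding, length_coding, hd] at hs
  have := eq_of_coding_eq hF hs le_rfl
  simpa using this

/-- Only the word [1] is used: the number of ones in a block telescopes to the increment of F across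
it, up to m⌊α⌋. -/
theorem Equivalent.eq_total (hF : IsRounding F) {k m : ℕ} (hk : 1 ≤ k) {y z : ℝ}
    (h : Equivalent k (coding F α y m) (coding F α z m)) :
    F (y + m * α) - F y = F (z + m * α) - F z := by
  rcases Nat.eq_zero_or_pos m with rfl | hm
  · simp
  have h1 := h [1] (by simp) (by simpa using hk)
  rw [occurrences_coding y m (by simp) (by simpa using Nat.succ_le_of_lt hm),
    occurrences_coding z m (by simp) (by simpa using Nat.succ_le_of_lt hm)] at h1
  have hs : ∀ x : ℝ, (((Finset.range (m - [(1 : Fin 2)].length + 1)).filter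
      fun i : ℕ => coding F α (x + i * α) [(1 : Fin 2)].length = [1]).card : ℤ) =
      F (x + m * α) - F x - m * ⌊α⌋ := by
    intro x
    rw [← Finset.sum_boole]
    have hm' : m - [(1 : Fin 2)].length + 1 = m := by simp; omega
    rw [hm']
    have : ∀ i ∈ Finset.range m,
        (if coding F α (x + i * α) [(1 : Fin 2)].length = [1] then (1 : ℤ) else 0) =
          F (x + (i + 1 : ℕ) * α) - F (x + i * α) - ⌊α⌋ := by
      intro i _
      have e : x + (i + 1 : ℕ) * α = x + i * α + α := by push_cast; ring
      rw [e, ← letter_eq_one_indicator hF]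
      simp [coding]
    rw [Finset.sum_congr rfl this, Finset.sum_sub_distrib,
      Finset.sum_range_sub fun i : ℕ => F (x + i * α)]
    simp
  have := hs y
  rw [h1, hs z] at this
  linarith

end span

/-! ### Level intervals and their maximal length -/

section levels

theorem exists_levelInterval (α : ℝ) (N : ℕ) :
    ∃ p ∈ levelIntervals α N, maxLevelLength α N = p.2 - p.1 :=
  Finset.exists_mem_eq_sup' (levelIntervals_nonempty α N) _

theorem maxLevelLength_pos (α : ℝ) (N : ℕ) : 0 < maxLevelLength α N := by
  obtain ⟨p, hp, h⟩ := exists_levelInterval α N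
  rw [h]
  exact sub_pos.2 (Finset.mem_filter.1 hp).2.1

theorem mem_Ico_of_mem_cutPoints {α c : ℝ} {N : ℕ} (h : c ∈ cutPoints α N) :
    c ∈ Set.Ico (0 : ℝ) 1 := by
  obtain ⟨i, -, rfl⟩ := Finset.mem_image.1 h
  exact ⟨Int.fract_nonneg _, Int.fract_lt_one _⟩

theorem zero_mem_cutPoints (α : ℝ) (N : ℕ) : (0 : ℝ) ∈ cutPoints α N :=
  Finset.mem_image.2 ⟨0, by simp, by simp⟩

/-- The gap extends to a level interval: from the last cut point at or before `lo` to the first one,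
or 1, at or after `hi`. -/
theorem sub_le_maxLevelLength {α lo hi : ℝ} {N : ℕ} (h0 : 0 ≤ lo) (h : lo < hi) (h1 : hi ≤ 1)
    (hc : ∀ c ∈ cutPoints α N, ¬(lo < c ∧ c < hi)) : hi - lo ≤ maxLevelLength α N := by
  have hA : ((cutPoints α N).filter (· ≤ lo)).Nonempty :=
    ⟨0, Finset.mem_filter.2 ⟨zero_mem_cutPoints α N, h0⟩⟩
  have hB : ((insert 1 (cutPoints α N)).filter (hi ≤ ·)).Nonempty :=
    ⟨1, Finset.mem_filter.2 ⟨Finset.mem_insert_self _ _, h1⟩⟩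
  have ha := Finset.mem_filter.1 (Finset.max'_mem _ hA)
  have hb := Finset.mem_filter.1 (Finset.min'_mem _ hB)
  have hle := fun x hx => Finset.le_max' ((cutPoints α N).filter (· ≤ lo)) x hx
  have hge := fun x hx => Finset.min'_le ((insert 1 (cutPoints α N)).filter (hi ≤ ·)) x hx
  set a := Finset.max' _ hA
  set b := Finset.min' _ hB
  have hmem : (a, b) ∈ levelIntervals α N := by
    refine Finset.mem_filter.2 ⟨Finset.mem_product.2 ⟨ha.1, hb.1⟩,
      (ha.2.trans_lt h).trans_le hb.2, fun c hcc hab => ?_⟩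
    have h2 : lo < c := by
      by_contra hn
      exact absurd (hle c (Finset.mem_filter.2 ⟨hcc, not_lt.1 hn⟩)) (not_le.2 hab.1)
    have h3 : c < hi := by
      by_contra hn
      exact absurd (hge c (Finset.mem_filter.2 ⟨Finset.mem_insert_of_mem hcc, not_lt.1 hn⟩))
        (not_le.2 hab.2)
    exact hc c hcc ⟨h2, h3⟩
  have := Finset.le_sup' (fun p : ℝ × ℝ => p.2 - p.1) hmem
  unfold maxLevelLength
  refine le_trans ?_ this
  have := ha.2
  have := hb.2
  simp only
  linarith

theorem sub_le_maxLevelLength_of_forall_int {α lo hi : ℝ} {N : ℕ}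
    (h : ∀ i : ℕ, i ≤ N → ∀ n : ℤ, ¬(lo + i * α < n ∧ n < hi + i * α)) :
    hi - lo ≤ maxLevelLength α N := by
  rcases le_or_gt hi lo with hlt | hlt
  · linarith [maxLevelLength_pos α N]
  -- The case i = 0 excludes integers inside the gap, so an integer translation moves it into [0,
  -- 1].
  have h1 : hi ≤ ⌊lo⌋ + 1 := by
    by_contra hn
    refine h 0 (Nat.zero_le _) (⌊lo⌋ + 1) ?_
    push_cast
    constructor <;> linarith [Int.lt_floor_add_one lo]
  have := sub_le_maxLevelLength (α := α) (N := N) (lo := lo - ⌊lo⌋) (hi := hi - ⌊lo⌋)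
    (by linarith [Int.floor_le lo]) (by linarith) (by linarith) ?_
  · linarith
  · intro c hc hcc
    obtain ⟨i, hi, rfl⟩ := Finset.mem_image.1 hc
    refine h i (Nat.lt_succ_iff.1 (Finset.mem_range.1 hi)) (⌊lo⌋ - ⌊-(i * α)⌋) ?_
    have := Int.self_sub_floor (-(i * α))
    push_cast
    constructor <;> linarith [hcc.1, hcc.2]

theorem maxLevelLength_zero (α : ℝ) : maxLevelLength α 0 = 1 := by
  refine le_antisymm ?_ ?_
  · obtain ⟨p, hp, h⟩ := exists_levelInterval α 0
    rw [h]
    have hp := Finset.mem_product.1 (Finset.mem_filter.1 hp).1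
    have h1 := mem_Ico_of_mem_cutPoints hp.1
    rcases Finset.mem_insert.1 hp.2 with h2 | h2
    · linarith [h1.1]
    · linarith [h1.1, (mem_Ico_of_mem_cutPoints h2).2]
  · have := sub_le_maxLevelLength (α := α) (N := 0) (lo := 0) (hi := 1) le_rfl one_pos le_rfl
      fun c hc h => by
        obtain ⟨i, hi, rfl⟩ := Finset.mem_image.1 hc
        have : i = 0 := by simpa using hi
        subst this
        simp at h
    linarith

/-- Shifting by −(k−1)α turns the offsets −(k−1), …, k−1 into 0, …, 2k−2; this is the origin of the
level 2k−2. -/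
theorem abs_sub_le_maxLevelLength {F : ℝ → ℤ} {α : ℝ} (hF : IsRounding F) {k : ℕ} (hk : 1 ≤ k)
    {u v : ℝ}
    (h1 : ∀ i : ℕ, i < k → F (u + i * α) = F (v + i * α))
    (h2 : ∀ i : ℕ, i < k → F (u - i * α) = F (v - i * α)) :
    |u - v| ≤ maxLevelLength α (2 * k - 2) := by
  have main : ∀ i : ℕ, i ≤ 2 * k - 2 →
      F (u - (k - 1 : ℕ) * α + i * α) = F (v - (k - 1 : ℕ) * α + i * α) := by
    intro i hi
    rcases le_total (k - 1) i with h | h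
    · obtain ⟨d, rfl⟩ := Nat.exists_eq_add_of_le h
      have e : ∀ u : ℝ, u - (k - 1 : ℕ) * α + (k - 1 + d : ℕ) * α = u + d * α := fun u => by
        push_cast
        ring
      rw [e, e, h1 d (by omega)]
    · obtain ⟨d, hd⟩ := Nat.exists_eq_add_of_le h
      have e : ∀ u : ℝ, u - (k - 1 : ℕ) * α + i * α = u - d * α := fun u => by
        rw [hd]
        push_cast
        ring
      rw [e, e, h2 d (by omega)]
  rw [abs_le']
  constructor
  · have := sub_le_maxLevelLength_of_forall_int (α := α) (N := 2 * k - 2)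
      (lo := v - (k - 1 : ℕ) * α) (hi := u - (k - 1 : ℕ) * α)
      fun i hi n hn => (hF.lt_of_lt_of_lt _ n _ hn.1 hn.2).ne' (main i hi)
    linarith
  · have := sub_le_maxLevelLength_of_forall_int (α := α) (N := 2 * k - 2)
      (lo := u - (k - 1 : ℕ) * α) (hi := v - (k - 1 : ℕ) * α)
      fun i hi n hn => (hF.lt_of_lt_of_lt _ n _ hn.1 hn.2).ne (main i hi)
    linarith

/-- A change of floor between u and v would place the cut point {−iα} strictly after the left
endpoint and before the right one. Half-open intervals match the right continuity of the floor. -/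
theorem floor_add_eq_of_mem_levelInterval {α : ℝ} {N : ℕ} {p : ℝ × ℝ}
    (hp : p ∈ levelIntervals α N) {u v : ℝ} (hu : u ∈ Set.Ico p.1 p.2) (hv : v ∈ Set.Ico p.1 p.2)
    {i : ℕ} (hi : i ≤ N) : ⌊u + i * α⌋ = ⌊v + i * α⌋ := by
  wlog huv : u ≤ v generalizing u v
  · exact (this hv hu (le_of_not_ge huv)).symm
  refine le_antisymm (Int.floor_mono (by linarith)) ?_
  by_contra hlt
  rw [not_le] at hlt
  have h1 := Int.floor_lt.1 hlt
  have h2 := Int.floor_le (v + i * α)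
  obtain ⟨hmem, hlt', hc⟩ := Finset.mem_filter.1 hp
  obtain ⟨h3, h4⟩ := Finset.mem_product.1 hmem
  have h5 := (mem_Ico_of_mem_cutPoints h3).1
  have h6 : p.2 ≤ 1 := by
    rcases Finset.mem_insert.1 h4 with h | h
    · exact h.le
    · exact (mem_Ico_of_mem_cutPoints h).2.le
  have e : Int.fract (-(i * α)) = ⌊v + i * α⌋ - i * α := by
    rw [Int.fract_eq_iff]
    refine ⟨by linarith [hu.1], by linarith [hv.2], -⌊v + i * α⌋, ?_⟩
    push_cast
    ring
  refine hc (⌊v + i * α⌋ - i * α) (Finset.mem_image.2 ⟨i, Finset.mem_range.2 (by omega), e⟩) ?_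
  constructor <;> linarith [hu.1, hv.2]

end levels

/-! ### The maximal exponent and the distance from mα to the nearest integer -/

section exponent

variable {α : ℝ}

theorem coding_add_mul (F : ℝ → ℤ) (hF : IsRounding F) (α y : ℝ) (j m N : ℕ) :
    coding F α (y + (j * m : ℕ) * α) N =
      coding F α (y + j * (m * α - round (m * α))) N := by
  have : y + (j * m : ℕ) * α = y + j * (m * α - round (m * α)) + ((j * round (m * α) : ℤ) : ℝ) := by
    push_cast
    ring
  rw [this, coding_add_int hF]

theorem le_of_forall_equivalent {F : ℝ → ℤ} (hF : IsRounding F) {k n m : ℕ} (hk : 1 ≤ k)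
    (hm : k ≤ m) {y : ℝ}
    (h : ∀ i < n, ∀ j < n, Equivalent k (coding F α (y + (i * m : ℕ) * α) m)
      (coding F α (y + (j * m : ℕ) * α) m)) :
    n ≤ 4 ∨ ((n - 2 : ℕ) : ℝ) * |m * α - round (m * α)| ≤ maxLevelLength α (2 * k - 2) := by
  by_contra! hcon
  obtain ⟨hn, hcon⟩ := hcon
  simp only [coding_add_mul F hF] at h
  set δ := m * α - round (m * α) with hδ
  have habs : |δ| ≤ 1 / 2 := abs_sub_round _
  have hstep : ∀ j : ℕ, y + j * δ + m * α = y + (j + 1 : ℕ) * δ + (round (m * α) : ℤ) := by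
    intro j
    push_cast
    rw [hδ]
    ring
  have htot : ∀ j < n, F (y + (j + 1 : ℕ) * δ) = F (y + j * δ) + (F (y + δ) - F y) := by
    intro j hj
    have := (h j hj 0 (by omega)).eq_total hF hk
    rw [hstep, hstep, hF.add_int, hF.add_int] at this
    simp at this
    push_cast
    linarith
  set c := F (y + δ) - F y with hc
  have hval : ∀ j ≤ n, F (y + j * δ) = F y + j * c := by
    intro j hj
    induction j with
    | zero => simp
    | succ j ih =>
      rw [htot j hj, ih (by omega)]
      push_cast
      ring
  have hc0 : c = 0 := by
    -- If c ≠ 0, then n·c is within 2 of nδ, whereas |c − δ| ≥ 1/2; this fails once n ≥ 5, hence the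
    -- exceptional case n ≤ 4.
    by_contra hne
    have h1 : (F (y + n * δ) : ℝ) = F y + n * c := by exact_mod_cast hval n le_rfl
    have h2 := hF.le_add_one (y + n * δ)
    have h3 := hF.sub_one_le (y + n * δ)
    have h4 := hF.le_add_one y
    have h5 := hF.sub_one_le y
    have h6 : (1 : ℝ) ≤ |(c : ℝ)| := by exact_mod_cast Int.one_le_abs hne
    have h7 : |(n : ℝ) * (c - δ)| ≤ 2 := by
      rw [abs_le]
      constructor <;> linarith
    rw [abs_mul, Nat.abs_cast] at h7
    have h8 : 1 / 2 ≤ |(c : ℝ) - δ| := by linarith [abs_sub_abs_le_abs_sub (c : ℝ) δ]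
    have h9 : (5 : ℝ) ≤ n := by exact_mod_cast hn
    nlinarith
  -- Modulo 1, y+δ and y+(n−1)δ are both starts and ends of blocks: they start blocks 1 and n−1 and
  -- end blocks 0 and n−2. So both forward and backward offsets are controlled.
  have := abs_sub_le_maxLevelLength (α := α) hF hk (u := y + (n - 2 + 1 : ℕ) * δ)
    (v := y + (0 + 1 : ℕ) * δ) ?_ ?_
  · have e : y + (n - 2 + 1 : ℕ) * δ - (y + (0 + 1 : ℕ) * δ) = (n - 2 : ℕ) * δ := by
      push_cast
      ring
    rw [e, abs_mul, Nat.abs_cast] at this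
    linarith
  · intro i hi
    have := (h (n - 2 + 1) (by omega) (0 + 1) (by omega)).eq_start hF hi (by omega)
    rw [hval _ (by omega), hval _ (by omega), hc0] at this
    simpa using this
  · intro i hi
    have := (h (n - 2) (by omega) 0 (by omega)).eq_end hF hi (by omega)
    have e : ∀ j : ℕ, y + j * δ + m * α - i * α =
        y + (j + 1 : ℕ) * δ - i * α + (round (m * α) : ℤ) := fun j => by
      rw [hstep]
      ring
    rw [e, e, hstep, hstep] at this
    simp only [hF.add_int] at this
    rw [hval _ (by omega), hval _ (by omega), hc0] at this
    linarith

theorem exists_isPower {k : ℕ} (hk : 1 ≤ k) {n m : ℕ}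
    (h : (n : ℝ) * |m * α - round (m * α)| < maxLevelLength α (2 * k - 2)) :
    ∃ y : ℝ, IsPower k n m (coding Int.floor α y (n * m)) := by
  obtain ⟨p, hp, hL⟩ := exists_levelInterval α (2 * k - 2)
  rw [hL] at h
  set δ := m * α - round (m * α) with hδ
  -- Index n is included because the last block ends at a+nδ, up to the shift by (k−1)α and an
  -- integer. For δ ≤ 0 the progression is placed so that its last point is the left endpoint.
  obtain ⟨a, ha⟩ : ∃ a : ℝ, ∀ j : ℕ, j ≤ n → a + j * δ ∈ Set.Ico p.1 p.2 := by
    rcases le_total 0 δ with h0 | h0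
    · rw [abs_of_nonneg h0] at h
      refine ⟨p.1, fun j hj => ?_⟩
      have h1 : (j : ℝ) * δ ≤ n * δ := by gcongr
      have h2 : 0 ≤ (j : ℝ) * δ := by positivity
      constructor <;> linarith
    · rw [abs_of_nonpos h0] at h
      refine ⟨p.1 - n * δ, fun j hj => ?_⟩
      have h1 : (j : ℝ) * -δ ≤ n * -δ := by
        have : 0 ≤ -δ := by linarith
        gcongr
      have h2 : 0 ≤ (j : ℝ) * -δ := mul_nonneg (Nat.cast_nonneg _) (by linarith)
      constructor <;> linarith
  refine ⟨a + (k - 1 : ℕ) * α, isPower_coding k n m _ fun i hi j hj => ?_⟩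
  rw [coding_add_mul _ isRounding_floor, coding_add_mul _ isRounding_floor, ← hδ]
  refine equivalent_coding isRounding_floor (fun r hr => ?_) fun r hr => ?_
  · have e : ∀ j : ℕ, a + (k - 1 : ℕ) * α + j * δ + r * α = a + j * δ + (k - 1 + r : ℕ) * α :=
      fun j => by
        push_cast
        ring
    rw [e, e]
    exact floor_add_eq_of_mem_levelInterval hp (ha i hi.le) (ha j hj.le) (by omega)
  · have e : ∀ j : ℕ, a + (k - 1 : ℕ) * α + j * δ + m * α - r * α =
        a + (j + 1 : ℕ) * δ + (k - 1 - r : ℕ) * α + (round (m * α) : ℤ) := by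
      intro j
      rw [Nat.cast_sub (show r ≤ k - 1 by omega), hδ]
      push_cast
      ring
    rw [e, e, Int.floor_add_intCast, Int.floor_add_intCast]
    congr 1
    exact floor_add_eq_of_mem_levelInterval hp (ha _ hi) (ha _ hj) (by omega)

theorem abs_sub_round_pos (hα : Irrational α) {m : ℕ} (hm : m ≠ 0) :
    0 < |m * α - round (m * α)| :=
  abs_pos.2 (sub_ne_zero.2 ((hα.natCast_mul hm).ne_int _))

theorem maxExponent_le (hα : Irrational α) {k m : ℕ} (hk : 1 ≤ k) (hm : k ≤ m) :
    (maxExponent k α m : ℝ≥0∞) ≤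
      ENNReal.ofReal (maxLevelLength α (2 * k - 2) / |m * α - round (m * α)|) + 4 := by
  have hd := abs_sub_round_pos hα (show m ≠ 0 by omega)
  set x := maxLevelLength α (2 * k - 2) / |m * α - round (m * α)| with hx
  have h1 : maxExponent k α m ≤ ((⌊x⌋₊ + 4 : ℕ) : ℕ∞) := by
    refine sSup_le ?_
    rintro _ ⟨n, rfl, u, hu, s, hs, hus⟩
    obtain ⟨z, F, hF, rfl⟩ := (isSturmian_iff hα s).1 hs
    obtain ⟨i, hi⟩ := (occursIn_iff F α z u).1 hus
    rw [hi] at hu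
    have := le_of_forall_equivalent (isRounding_of_eq hF) hk hm (exists_of_isPower_coding hu)
    rw [← le_div_iff₀ hd, ← hx] at this
    norm_cast
    rcases this with h | h
    · omega
    · have := Nat.le_floor h
      omega
  have h2 : (maxExponent k α m : ℝ≥0∞) ≤ (((⌊x⌋₊ + 4 : ℕ) : ℕ∞) : ℝ≥0∞) :=
    ENat.toENNReal_mono h1
  refine h2.trans ?_
  have h3 : ((⌊x⌋₊ : ℕ) : ℝ≥0∞) ≤ ENNReal.ofReal x := by
    rw [← ENNReal.ofReal_natCast]
    exact ENNReal.ofReal_le_ofReal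
      (Nat.floor_le (div_nonneg (maxLevelLength_pos α _).le hd.le))
  simpa using h3

theorem le_maxExponent (hα : Irrational α) {k m : ℕ} (hk : 1 ≤ k) (hm : m ≠ 0) :
    ENNReal.ofReal (maxLevelLength α (2 * k - 2) / |m * α - round (m * α)|) ≤
      maxExponent k α m + 1 := by
  have hd := abs_sub_round_pos hα hm
  set x := maxLevelLength α (2 * k - 2) / |m * α - round (m * α)| with hx
  have hx0 : 0 < x := div_pos (maxLevelLength_pos α _) hd
  have hc : 0 < ⌈x⌉₊ := Nat.ceil_pos.2 hx0
  -- The largest natural number strictly below x, since the progression must fit in a half-open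
  -- interval.
  have hlt : ((⌈x⌉₊ - 1 : ℕ) : ℝ) < x := Nat.lt_ceil.1 (by omega)
  rw [hx, lt_div_iff₀ hd] at hlt
  obtain ⟨y, hy⟩ := exists_isPower hk hlt
  have h1 : ((⌈x⌉₊ - 1 : ℕ) : ℕ∞) ≤ maxExponent k α m := by
    refine le_sSup ⟨_, rfl, _, hy, _,
      (isSturmian_iff hα _).2 ⟨y, Int.floor, .inl rfl, rfl⟩, ?_⟩
    rw [occursIn_iff]
    exact ⟨0, by simp⟩
  have h2 : (((⌈x⌉₊ - 1 : ℕ) : ℕ∞) : ℝ≥0∞) ≤ (maxExponent k α m : ℝ≥0∞) := ENat.toENNReal_mono h1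
  calc ENNReal.ofReal x ≤ ENNReal.ofReal (⌈x⌉₊ : ℝ) := ENNReal.ofReal_le_ofReal (Nat.le_ceil x)
    _ = (((⌈x⌉₊ - 1 : ℕ) : ℕ∞) : ℝ≥0∞) + 1 := by
      rw [ENNReal.ofReal_natCast]
      norm_cast
      rw [Nat.sub_add_cancel hc]
    _ ≤ _ := by gcongr

open Filter Topology

/-- The limit superior of `1 / (m‖mα‖)`. -/
noncomputable def lagrangeConstant (α : ℝ) : ℝ≥0∞ :=
  limsup (fun m : ℕ => ENNReal.ofReal (1 / (m * |m * α - round (m * α)|))) atTop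

theorem criticalExponent_eq_mul_lagrangeConstant (hα : Irrational α) {k : ℕ} (hk : 1 ≤ k) :
    criticalExponent k α = ENNReal.ofReal (maxLevelLength α (2 * k - 2)) * lagrangeConstant α := by
  set L := maxLevelLength α (2 * k - 2) with hL
  have hL0 : 0 ≤ L := (maxLevelLength_pos α _).le
  rw [lagrangeConstant, ← ENNReal.limsup_const_mul_of_ne_top ENNReal.ofReal_ne_top]
  have key : ∀ m : ℕ, m ≠ 0 →
      ENNReal.ofReal L * ENNReal.ofReal (1 / (m * |m * α - round (m * α)|)) =
        ENNReal.ofReal (L / |m * α - round (m * α)|) / m := by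
    intro m hm
    have hm' : (0 : ℝ) < m := by positivity
    have hd := abs_sub_round_pos hα hm
    rw [← ENNReal.ofReal_mul hL0, ← ENNReal.ofReal_natCast m,
      ← ENNReal.ofReal_div_of_pos hm']
    congr 1
    field_simp
  have hlim : ∀ c : ℝ≥0∞, c ≠ ⊤ → Tendsto (fun m : ℕ => c / (m : ℝ≥0∞)) atTop (𝓝 0) := by
    intro c hc
    simpa [div_eq_mul_inv] using
      ENNReal.Tendsto.const_mul ENNReal.tendsto_inv_nat_nhds_zero (.inr hc)
  unfold criticalExponent
  refine le_antisymm ?_ ?_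
  · rw [← ENNReal.limsup_add_of_right_tendsto_zero (hlim 4 (by simp))
      (fun m : ℕ => ENNReal.ofReal L * ENNReal.ofReal (1 / (m * |m * α - round (m * α)|)))]
    refine limsup_le_limsup ?_
    filter_upwards [eventually_ge_atTop k] with m hm
    rw [Pi.add_apply, key m (by omega), ← ENNReal.add_div]
    exact ENNReal.div_le_div_right (maxExponent_le hα hk hm) _
  · rw [← ENNReal.limsup_add_of_right_tendsto_zero (hlim 1 (by simp))
      (fun m : ℕ => (maxExponent k α m : ℝ≥0∞) / (m : ℝ≥0∞))]
    refine limsup_le_limsup ?_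
    filter_upwards [eventually_ne_atTop 0] with m hm
    rw [Pi.add_apply, key m hm, ← ENNReal.add_div]
    exact ENNReal.div_le_div_right (le_maxExponent hα hk hm) _

end exponent

/-! ### Bounded partial quotients and approximation by convergents -/

section continuedFraction

open GenContFract Filter

variable {α : ℝ}

theorem not_terminatedAt_of_irrational (hα : Irrational α) (n : ℕ) :
    ¬(GenContFract.of α).TerminatedAt n := fun h => by
  obtain ⟨q, hq⟩ := (GenContFract.terminates_iff_rat α).1 ⟨n, h⟩
  exact hα ⟨q, hq.symm⟩

theorem exists_partDens_eq_some (hα : Irrational α) (n : ℕ) :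
    ∃ b : ℝ, (GenContFract.of α).partDens.get? n = some b := by
  have := not_terminatedAt_of_irrational hα n
  rw [terminatedAt_iff_partDen_none] at this
  exact Option.ne_none_iff_exists'.1 this

theorem exists_int_contsAux_eq (hα : Irrational α) (n : ℕ) :
    ∃ a b : ℤ, (GenContFract.of α).contsAux n = ⟨a, b⟩ := by
  induction n using Nat.twoStepInduction with
  | zero => exact ⟨1, 0, by simp [contsAux]⟩
  | one => exact ⟨⌊α⌋, 1, by simp [contsAux]⟩
  | more n ih1 ih2 =>
    obtain ⟨a1, b1, h1⟩ := ih1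
    obtain ⟨a2, b2, h2⟩ := ih2
    obtain ⟨gp, hgp⟩ : ∃ gp, (GenContFract.of α).s.get? n = some gp :=
      Option.ne_none_iff_exists'.1 (not_terminatedAt_of_irrational hα n)
    obtain ⟨ha, z, hz⟩ := of_partNum_eq_one_and_exists_int_partDen_eq hgp
    refine ⟨z * a2 + a1, z * b2 + b1, ?_⟩
    rw [contsAux_recurrence hgp h1 h2, ha, hz]
    push_cast
    simp

theorem exists_int_convs_eq (hα : Irrational α) (n : ℕ) : ∃ a b : ℤ,
    (GenContFract.of α).nums n = a ∧ (GenContFract.of α).dens n = b ∧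
      0 < b ∧ (n : ℤ) ≤ b ∧ IsCoprime a b := by
  obtain ⟨a, b, h⟩ := exists_int_contsAux_eq hα (n + 1)
  obtain ⟨a', b', h'⟩ := exists_int_contsAux_eq hα (n + 2)
  have hn : (GenContFract.of α).nums n = a := congrArg Pair.a h
  have hd : (GenContFract.of α).dens n = b := congrArg Pair.b h
  have hn' : (GenContFract.of α).nums (n + 1) = a' := congrArg Pair.a h'
  have hd' : (GenContFract.of α).dens (n + 1) = b' := congrArg Pair.b h'
  have hfib := succ_nth_fib_le_of_nth_den (v := α) (n := n)
    (.inr (not_terminatedAt_of_irrational hα _))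
  rw [hd] at hfib
  have hfib' : (Nat.fib (n + 1) : ℤ) ≤ b := by exact_mod_cast hfib
  have h1 : 0 < Nat.fib (n + 1) := Nat.fib_pos.2 n.succ_pos
  have h2 := Nat.le_fib_add_one (n + 1)
  refine ⟨a, b, hn, hd, by omega, by omega, ?_⟩
  have hdet := (SimpContFract.of α).determinant (n := n) (not_terminatedAt_of_irrational hα n)
  change (GenContFract.of α).nums n * (GenContFract.of α).dens (n + 1) -
    (GenContFract.of α).dens n * (GenContFract.of α).nums (n + 1) = (-1) ^ (n + 1) at hdet
  rw [hn, hd, hn', hd'] at hdet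
  have hdet' : a * b' - b * a' = (-1) ^ (n + 1) := by exact_mod_cast hdet
  rcases neg_one_pow_eq_or ℤ (n + 1) with h | h <;> rw [h] at hdet'
  · exact ⟨b', -a', by linarith⟩
  · exact ⟨-b', a', by linarith⟩

theorem contsAux_b_le_dens (n : ℕ) :
    ((GenContFract.of α).contsAux n).b ≤ (GenContFract.of α).dens n := by
  cases n with
  | zero => simp [contsAux]
  | succ n => exact of_den_mono

/-- A lower bound for the error of a convergent in terms of the next partial quotient. -/
theorem one_div_le_abs_sub_convs (hα : Irrational α) {n : ℕ} {b : ℝ}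
    (hb : (GenContFract.of α).partDens.get? n = some b) :
    1 / ((GenContFract.of α).dens n ^ 2 * (b + 2)) ≤ |α - (GenContFract.of α).convs n| := by
  obtain ⟨gp, hgp, rfl⟩ := exists_s_b_of_partDen hb
  obtain ⟨ifp', hs', hb'⟩ := IntFractPair.exists_succ_get?_stream_of_gcf_of_get?_eq_some hgp
  obtain ⟨ifp, hs, hfr, hof⟩ := IntFractPair.succ_nth_stream_eq_some_iff.1 hs'
  have hfl : (⌊ifp.fr⁻¹⌋ : ℝ) = gp.b := by
    rw [← hb', ← hof]
    rfl
  have h1 : ifp.fr⁻¹ < gp.b + 1 := by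
    rw [← hfl]
    exact Int.lt_floor_add_one _
  have h0 : 0 < ifp.fr⁻¹ :=
    inv_pos.2 (hfr.symm.lt_of_le (IntFractPair.nth_stream_fr_nonneg hs))
  -- With q_n the denominators, the error is ±1/(q_n(q_n/fr + q_{n−1})); the bound follows from 1/fr
  -- < b + 1 and q_{n−1} ≤ q_n.
  have heq := sub_convs_eq hs
  simp only [hfr, if_false] at heq
  obtain ⟨-, B, -, hB, hBpos, -⟩ := exists_int_convs_eq hα n
  have hd : 0 < (GenContFract.of α).dens n := by
    rw [hB]
    exact_mod_cast hBpos
  have hd' : ((GenContFract.of α).contsAux (n + 1)).b = (GenContFract.of α).dens n := rfl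
  have hp : 0 ≤ ((GenContFract.of α).contsAux n).b := zero_le_of_contsAux_b
  have hle := contsAux_b_le_dens (α := α) n
  rw [hd'] at heq
  rw [heq, abs_div, abs_neg_one_pow, abs_of_pos (by positivity)]
  refine one_div_le_one_div_of_le (by positivity) ?_
  rw [pow_two, mul_assoc]
  gcongr
  nlinarith

/-- Unless m‖mα‖ ≥ 1/2, Legendre's theorem makes round(mα)/m a convergent. Its reduced denominator
divides m, so the error bound for convergents carries over to m. -/
theorem one_div_le_mul_abs_sub_round (hα : Irrational α) {C : ℝ}
    (hC : ∀ (t : ℕ) (a : ℝ), (GenContFract.of α).partDens.get? t = some a → a ≤ C) {m : ℕ}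
    (hm : m ≠ 0) : 1 / (C + 2) ≤ m * |m * α - round (m * α)| := by
  have hm0 : (0 : ℝ) < m := by positivity
  have hC1 : 1 ≤ C := by
    obtain ⟨b, hb⟩ := exists_partDens_eq_some hα 0
    exact (of_one_le_get?_partDen hb).trans (hC 0 b hb)
  rcases le_or_gt (1 / 2) (m * |m * α - round (m * α)|) with h | h
  · refine le_trans ?_ h
    exact one_div_le_one_div_of_le (by norm_num) (by linarith)
  set q : ℚ := round (m * α) / m with hq
  have hqr : (q : ℝ) = round (m * α) / m := by simp [hq]
  have hdiff : m * |m * α - round (m * α)| = m ^ 2 * |α - q| := by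
    have : m * α - round (m * α) = m * (α - q) := by
      rw [hqr]
      field_simp
    rw [this, abs_mul, Nat.abs_cast]
    ring
  have hden : (q.den : ℤ) ∣ m := by
    have : q = Rat.divInt (round (m * α)) m := by
      rw [hq, Rat.divInt_eq_div]
      simp
    rw [this]
    exact Rat.den_dvd _ _
  have hdenle : (q.den : ℝ) ≤ m := by
    exact_mod_cast Nat.le_of_dvd (Nat.pos_of_ne_zero hm) (Int.natCast_dvd_natCast.1 hden)
  have hdpos : (0 : ℝ) < q.den := by exact_mod_cast q.pos
  have hlt : |α - q| < 1 / (2 * (q.den : ℝ) ^ 2) := by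
    rw [lt_div_iff₀ (by positivity)]
    rw [hdiff] at h
    have : (q.den : ℝ) ^ 2 * |α - q| ≤ m ^ 2 * |α - q| := by gcongr
    linarith
  obtain ⟨n, hn⟩ := Real.exists_convs_eq_rat hlt
  obtain ⟨b, hb⟩ := exists_partDens_eq_some hα n
  have hbC := hC n b hb
  have hb1 := of_one_le_get?_partDen hb
  have hlow := one_div_le_abs_sub_convs hα hb
  rw [hn] at hlow
  obtain ⟨A, B, hA, hB, hBpos, -, hcop⟩ := exists_int_convs_eq hα n
  rw [hB] at hlow
  have hBr : (0 : ℝ) < B := by exact_mod_cast hBpos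
  have hBle : (B : ℝ) ≤ m := by
    have h1 : (q : ℝ) = A / B := by rw [← hn, conv_eq_num_div_den, hA, hB]
    rw [hqr, div_eq_div_iff hm0.ne' hBr.ne'] at h1
    have h2 : round (m * α) * B = A * m := by exact_mod_cast h1
    have h3 : B ∣ m := hcop.symm.dvd_of_dvd_mul_left ⟨round (m * α), by linarith⟩
    have h4 := Int.le_of_dvd (by omega) h3
    exact_mod_cast h4
  rw [hdiff]
  calc 1 / (C + 2) ≤ 1 / (b + 2) := one_div_le_one_div_of_le (by linarith) (by linarith)
    _ = B ^ 2 * (1 / (B ^ 2 * (b + 2))) := by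
      field_simp
    _ ≤ m ^ 2 * |α - q| := by gcongr

theorem lagrangeConstant_lt_top_of_bounded (hα : Irrational α)
    (h : HasBoundedPartialQuotients α) : lagrangeConstant α < ⊤ := by
  obtain ⟨C, hC⟩ := h
  refine lt_of_le_of_lt (limsup_le_of_le (by isBoundedDefault) (a := ENNReal.ofReal (C + 2)) ?_)
    ENNReal.ofReal_lt_top
  filter_upwards [eventually_ne_atTop 0] with m hm
  refine ENNReal.ofReal_le_ofReal ?_
  have hC1 : 1 ≤ C := by
    obtain ⟨b, hb⟩ := exists_partDens_eq_some hα 0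
    exact (of_one_le_get?_partDen hb).trans (hC 0 b hb)
  have := one_div_le_one_div_of_le (by positivity) (one_div_le_mul_abs_sub_round hα hC hm)
  rwa [one_div_one_div] at this

/-- A large partial quotient b after the convergent with denominator q gives q‖qα‖ ≤ 1/b.
Denominators are at least their index, so only finitely many escape the eventual bound K; the sum
absorbs these. -/
theorem hasBoundedPartialQuotients_of_lt_top (hα : Irrational α)
    (h : lagrangeConstant α < ⊤) : HasBoundedPartialQuotients α := by
  obtain ⟨K, hK, -⟩ := ENNReal.lt_iff_exists_nnreal_btwn.1 h
  obtain ⟨M, hM⟩ := eventually_atTop.1 (eventually_lt_of_limsup_lt hK)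
  set f : ℕ → ℝ := fun n => ((GenContFract.of α).partDens.get? n).getD 0 with hf
  refine ⟨K + ∑ n ∈ Finset.range (M + 1), |f n|, fun n b hb => ?_⟩
  have hfn : f n = b := by simp [hf, hb]
  have hsum : 0 ≤ ∑ n ∈ Finset.range (M + 1), |f n| := Finset.sum_nonneg fun _ _ => abs_nonneg _
  rcases lt_or_ge n (M + 1) with hn | hn
  · have := Finset.single_le_sum (f := fun n => |f n|) (fun _ _ => abs_nonneg _)
      (Finset.mem_range.2 hn)
    simp only [hfn] at this
    linarith [le_abs_self b, K.coe_nonneg]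
  · have hb1 := of_one_le_get?_partDen hb
    obtain ⟨A, B, hA, hB, hBpos, hnB, -⟩ := exists_int_convs_eq hα n
    lift B to ℕ using hBpos.le
    rw [Int.cast_natCast] at hB
    have hBr : (0 : ℝ) < B := by exact_mod_cast hBpos
    have h1 := abs_sub_convergents_le' hb
    rw [conv_eq_num_div_den, hA, hB] at h1
    have hd := abs_sub_round_pos hα (m := B) (by omega)
    have h2 : |B * α - round (B * α)| ≤ 1 / (b * B) := by
      calc |B * α - round (B * α)| ≤ |B * α - A| := round_le _ _
        _ = B * |α - A / B| := by
          rw [← abs_of_pos hBr, ← abs_mul, abs_of_pos hBr]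
          congr 1
          field_simp
        _ ≤ B * (1 / (b * B * B)) := by gcongr
        _ = 1 / (b * B) := by field_simp
    have h3 : b ≤ 1 / (B * |B * α - round (B * α)|) := by
      rw [le_div_iff₀ (by positivity)]
      rw [le_div_iff₀ (by positivity)] at h2
      linarith
    have h4 := hM B (by omega)
    rw [ENNReal.ofReal_lt_coe_iff (by positivity)] at h4
    linarith

end continuedFraction

end KAbelian

theorem mainTheorem1 (α : ℝ) (hα : Irrational α) (k : ℕ) (hk : 1 ≤ k) :
    (∀ s : ℕ → Fin 2, KAbelian.IsSturmian α s →
      ∀ m : ℕ, 1 ≤ m → KAbelian.maxExponentOfWord k s m = KAbelian.maxExponent k α m) ∧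
    KAbelian.criticalExponent k α =
      ENNReal.ofReal (KAbelian.maxLevelLength α (2 * k - 2)) * KAbelian.criticalExponent 1 α ∧
    (KAbelian.criticalExponent k α < ⊤ ↔ KAbelian.HasBoundedPartialQuotients α) := by
  have hcrit := KAbelian.criticalExponent_eq_mul_lagrangeConstant hα hk
  refine ⟨fun s hs m _ => KAbelian.maxExponentOfWord_eq_maxExponent hα hs k m, ?_, ?_⟩
  · rw [hcrit, KAbelian.criticalExponent_eq_mul_lagrangeConstant hα le_rfl]
    simp [KAbelian.maxLevelLength_zero]
  -- Positivity of the factor is essential: in `ℝ≥0∞` a zero factor would hide an infinite limit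
  -- superior.
  · have hL : ENNReal.ofReal (KAbelian.maxLevelLength α (2 * k - 2)) ≠ 0 :=
      (ENNReal.ofReal_pos.2 (KAbelian.maxLevelLength_pos α _)).ne'
    rw [hcrit]
    constructor
    · intro h
      refine KAbelian.hasBoundedPartialQuotients_of_lt_top hα ?_
      rw [lt_top_iff_ne_top] at h ⊢
      exact fun e => h (by rw [e, ENNReal.mul_top hL])
    · exact fun h => ENNReal.mul_lt_top ENNReal.ofReal_lt_top
        (KAbelian.lagrangeConstant_lt_top_of_bounded hα h)
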